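/- For $n\ge 0$ and $x,y\in\{0,1\}^n$ let $x\wedge y$ be the bitwise AND and $|\cdot|$ the Hamming weight. Let $\mathrm{EQ}(x,y)=1$ iff $x=y$, $\mathrm{DISJ}(x,y)=1$ iff $|x\wedge y|=0$, and $\mathrm{IP}(x,y)=1$ iff $|x\wedge y|$ is odd. For a Boolean function $f:X\times Y\to\{0,1\}$ let $M_f$ be the matrix with entries $f(x,y)$ and $\mathrm{rank}(f)$ its rank over $\mathbb R$. Alice receives $x$ and Bob receives $y$. They start with any finite number of shared EPR-pairs, all other qubits (any finite number on each side) being $|0\rangle$. In a qubit protocol the parties send qubits one at a time; the sender first applies a unitary, depending on the sender's own input, to all qubits in the sender's hands and then hands one qubit over. Who sends at which step, and the number of steps, are fixed by the protocol and do not depend on the inputs. The output is the result of measuring the channel qubit (the qubit sent last) in the computational basis. In a protocol with classical communication the sender instead applies a unitary, depending on the sender's own input and on all bits sent so far, to the sender's own qubits, measures one of them in the computational basis and sends the outcome; again who sends when is fixed, and the last bit sent is the output. (In both models the channel holds $0$ before anything is sent.) A protocol computes $f$ exactly if on every input $(x,y)$ its output is $f(x,y)$ with probability $1$. Let $Q^*(f)$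 be the least number of qubits sent in an exact qubit protocol for $f$, and $C^*(f)$ the least number of bits sent in an exact protocol for $f$ with classical communication. Then for every $n\ge 0$: 1. $\mathrm{rank}(\mathrm{EQ})=\mathrm{rank}(\mathrm{DISJ})=\mathrm{rank}(\overline{\mathrm{IP}})=2^n$, where $\overline{\mathrm{IP}}=1-\mathrm{IP}$. 2. $Q^*(f)\ge n/2$ and $C^*(f)\ge n$ for each $f\in\{\mathrm{EQ},\mathrm{DISJ},\mathrm{IP}\}$. 3. These bounds are tight up to one (qu)bit: $Q^*(f)\le\lceil n/2\rceil+1$ and $C^*(f)\le n+1$ for each $f\in\{\mathrm{EQ},\mathrm{DISJ},\mathrm{IP}\}$. -/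

import Mathlib

open scoped Kronecker Matrix ENNReal

noncomputable section

/-! ### Boolean functions and their communication matrices -/

/-- Bit strings of length `n`; also the labels of the computational basis of `n` qubits. -/
abbrev Bits (n : ℕ) : Type := Fin n → Bool

/-- Hamming weight. -/
def Bits.weight {n : ℕ} (x : Bits n) : ℕ := (Finset.univ.filter fun i => x i = true).card

/-- Bitwise AND. -/
def Bits.and {n : ℕ} (x y : Bits n) : Bits n := fun i => x i && y i

/-- Equality: `1` iff `x = y`. -/
def EQ (n : ℕ) (x y : Bits n) : Bool := decide (x = y)

/-- Disjointness: `1` iff `|x ∧ y| = 0`. -/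
def DISJ (n : ℕ) (x y : Bits n) : Bool := decide ((x.and y).weight = 0)

/-- Inner product: `1` iff `|x ∧ y|` is odd. -/
def IP (n : ℕ) (x y : Bits n) : Bool := decide (Odd (x.and y).weight)

/-- The complement (negation) of a Boolean function. -/
def complement {X Y : Type} (f : X → Y → Bool) (x : X) (y : Y) : Bool := !(f x y)

/-- The communication matrix `M_f` over the reals. -/
def commMatrix {X Y : Type} (f : X → Y → Bool) : Matrix X Y ℝ :=
  Matrix.of fun x y => if f x y = true then 1 else 0

/-! ### Two-party quantum states -/

/-- A (possibly unnormalized) state vector of `a` qubits held by Alice and `b` qubits held by Bob,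
given by its amplitudes in the computational basis. -/
abbrev QState (a b : ℕ) : Type := Bits a × Bits b → ℂ

/-- Unitary operations on `n` qubits. -/
abbrev Gate (n : ℕ) : Type := Matrix.unitaryGroup (Bits n) ℂ

/-- Alice applies `U` to her qubits. -/
def QState.alice {a b : ℕ} (U : Gate a) (ψ : QState a b) : QState a b :=
  ((U : Matrix (Bits a) (Bits a) ℂ) ⊗ₖ (1 : Matrix (Bits b) (Bits b) ℂ)) *ᵥ ψ

/-- Bob applies `V` to his qubits. -/
def QState.bob {a b : ℕ} (V : Gate b) (ψ : QState a b) : QState a b :=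
  ((1 : Matrix (Bits a) (Bits a) ℂ) ⊗ₖ (V : Matrix (Bits b) (Bits b) ℂ)) *ᵥ ψ

/-- Alice's qubit number `0` is handed over to Bob, where it becomes his qubit number `0`. -/
def QState.toBob {a b : ℕ} (ψ : QState (a + 1) b) : QState a (b + 1) :=
  fun p => ψ (Fin.cons (p.2 0) p.1, Fin.tail p.2)

/-- Bob's qubit number `0` is handed over to Alice, where it becomes her qubit number `0`. -/
def QState.toAlice {a b : ℕ} (ψ : QState a (b + 1)) : QState (a + 1) b :=
  fun p => ψ (Fin.tail p.1, Fin.cons (p.1 0) p.2)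

/-- The unnormalized state after the outcome `m` when a bit that is a function `g` of the
computational basis label is measured; its squared norm is the probability of that outcome. -/
def QState.project {a b : ℕ} (g : Bits a × Bits b → Bool) (m : Bool) (ψ : QState a b) :
    QState a b :=
  fun p => if g p = m then ψ p else 0

/-- The squared norm of a state vector. -/
def QState.normSq {a b : ℕ} (ψ : QState a b) : ℝ := ∑ p, ‖ψ p‖ ^ 2

/-- The initial state: Alice and Bob share `k` EPR-pairs `(|00⟩ + |11⟩)/√2` (the first `k` qubits
on each side), and Alice's `a` and Bob's `b` other qubits are zero. -/
def QState.initial (k a b : ℕ) : QState (k + a) (k + b) := fun p =>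
  if (∀ i : Fin k, p.1 (Fin.castAdd a i) = p.2 (Fin.castAdd b i)) ∧
      (∀ i : Fin a, p.1 (Fin.natAdd k i) = false) ∧
      (∀ j : Fin b, p.2 (Fin.natAdd k j) = false)
  then (((Real.sqrt 2)⁻¹ : ℝ) : ℂ) ^ k else 0

/-! ### Qubit protocols -/

/-- Qubit protocols for inputs `x : X` of Alice and `y : Y` of Bob, from a point at which Alice
holds `a` qubits and Bob holds `b` qubits.  In each step the party whose turn it is applies a unitary
that depends on the own input to all qubits in its hands, and then one of these qubits is sent
through the channel to the other party.  Who sends when is fixed by the protocol and does not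
depend on the inputs; a party that sends `q` qubits in one round has `q` consecutive steps. -/
inductive QubitProtocol (X Y : Type) : ℕ → ℕ → Type
  | done {a b : ℕ} : QubitProtocol X Y a b
  | alice {a b : ℕ} (U : X → Gate (a + 1)) (next : QubitProtocol X Y a (b + 1)) :
      QubitProtocol X Y (a + 1) b
  | bob {a b : ℕ} (V : Y → Gate (b + 1)) (next : QubitProtocol X Y (a + 1) b) :
      QubitProtocol X Y a (b + 1)

/-- The number of qubits communicated. -/
def QubitProtocol.cost {X Y : Type} : {a b : ℕ} → QubitProtocol X Y a b → ℕ
  | _, _, .done => 0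
  | _, _, .alice _ next => next.cost + 1
  | _, _, .bob _ next => next.cost + 1

/-- The probability of the output `c` on the input `(x, y)`, when the protocol is run from the state
`ψ`.  The output is read off the channel qubit: `chan` gives the value of that qubit for each
computational basis label. -/
def QubitProtocol.outProb {X Y : Type} (x : X) (y : Y) (c : Bool) : {a b : ℕ} →
    QubitProtocol X Y a b → (chan : Bits a × Bits b → Bool) → QState a b → ℝ
  | _, _, .done, chan, ψ => (ψ.project chan c).normSq
  | _, _, .alice U next, _, ψ => next.outProb x y c (fun p => p.2 0) (ψ.alice (U x)).toBob
  | _, _, .bob V next, _, ψ => next.outProb x y c (fun p => p.1 0) (ψ.bob (V y)).toAlice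

/-- The protocol, started with `k` EPR-pairs and all other qubits zero (so that the channel holds
`0` as long as nothing has been sent), computes `f` exactly. -/
def QubitProtocol.Computes {X Y : Type} {k a b : ℕ} (P : QubitProtocol X Y (k + a) (k + b))
    (f : X → Y → Bool) : Prop :=
  ∀ x y, P.outProb x y (f x y) (fun _ => false) (QState.initial k a b) = 1

/-- `Q*(f)`: the least number of qubits communicated in an exact qubit protocol for `f` that may
start with any finite number of shared EPR-pairs. -/
def qStar {X Y : Type} (f : X → Y → Bool) : ℕ∞ :=
  sInf {c | ∃ (k a b : ℕ) (P : QubitProtocol X Y (k + a) (k + b)),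
    P.Computes f ∧ c = (P.cost : ℕ∞)}

/-! ### Classical communication with shared EPR-pairs -/

/-- The two parties. -/
inductive Party : Type
  | alice
  | bob

/-- Protocols with classical communication, where Alice holds `a` qubits and Bob holds `b` qubits,
indexed by the list of senders of the bits that are still to be sent.  In each step the sender applies
a unitary to the own qubits, measures one of them in the computational basis, and sends the outcome
to the other party.  What is done later may depend on that bit (and on the own input), but who
sends when is fixed. -/
inductive BitProtocol (X Y : Type) (a b : ℕ) : List Party → Type
  | done : BitProtocol X Y a b []
  | alice {s : List Party} (i : Fin a) (U : X → Gate a) (next : Bool → BitProtocol X Y a b s) :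
      BitProtocol X Y a b (Party.alice :: s)
  | bob {s : List Party} (j : Fin b) (V : Y → Gate b) (next : Bool → BitProtocol X Y a b s) :
      BitProtocol X Y a b (Party.bob :: s)

/-- The probability of the output `c` on the input `(x, y)`, when the protocol is run from the
(unnormalized) state `ψ`.  The output is the bit that was sent last, `chan`. -/
def BitProtocol.outProb {X Y : Type} {a b : ℕ} (x : X) (y : Y) (c : Bool) : {s : List Party} →
    BitProtocol X Y a b s → (chan : Bool) → QState a b → ℝ
  | _, .done, chan, ψ => if chan = c then ψ.normSq else 0
  | _, .alice i U next, _, ψ =>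
      ∑ m : Bool, (next m).outProb x y c m ((ψ.alice (U x)).project (fun p => p.1 i) m)
  | _, .bob j V next, _, ψ =>
      ∑ m : Bool, (next m).outProb x y c m ((ψ.bob (V y)).project (fun p => p.2 j) m)

/-- The protocol, started with `k` EPR-pairs and all other qubits zero (and with `0` on the channel
as long as nothing has been sent), computes `f` exactly. -/
def BitProtocol.Computes {X Y : Type} {k a b : ℕ} {s : List Party}
    (P : BitProtocol X Y (k + a) (k + b) s) (f : X → Y → Bool) : Prop :=
  ∀ x y, P.outProb x y (f x y) false (QState.initial k a b) = 1

/-- `C*(f)`: the least number of classical bits communicated in an exact protocol for `f` that may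
start with any finite number of shared EPR-pairs. -/
def cStar {X Y : Type} (f : X → Y → Bool) : ℕ∞ :=
  sInf {c | ∃ (k a b : ℕ) (s : List Party) (P : BitProtocol X Y (k + a) (k + b) s),
    P.Computes f ∧ c = (s.length : ℕ∞)}

end

/-! Lower bounds: in the Heisenberg picture a protocol is a two-outcome measurement `T c x y` on its
starting state. Pulling an operator back through a local unitary or a local projector keeps the
number of product terms `A x ⊗ B y`; a transmitted qubit multiplies it by 4, because an operator on
that qubit splits into four blocks, and a classical bit by 2, because two outcomes are summed
(`QubitProtocol.isSepMeasurement`, `BitProtocol.isSepMeasurement`).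

If the protocol is exact, positivity forces the starting state `ψ` to be an eigenvector of `T c x
y`, with eigenvalue 1 or 0 according to whether `f x y = c`. The state is therefore undisturbed and
can be reused: the product of `m` such operators for independent inputs has at most `r ^ m` terms,
and its expectation in `ψ` is the `m`-fold Kronecker power of the 0-1 matrix of `f`. The
entanglement contributes only a factor independent of `m`, so `|X| ^ m ≤ r ^ m * const` for all `m`,
whence `|X| ≤ r` when the 0-1 matrix is invertible (`HasSepRank.card_le_of_eigenvector`,
`IsSepMeasurement.card_le`). Explicit inverses for EQ, DISJ and the complement of IP also give the
ranks.

Upper bounds hold for every `f`: Alice communicates all of `x`, in `n` classical bits or by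
superdense coding in `⌈n/2⌉` qubits, and Bob returns the answer. -/

noncomputable section

/-! ### Families of operators of small separable rank -/

section SepRank

variable {X Y X' Y' α β : Type}

/-- `T x y` is a sum of `r` tensor products of an operator depending on `x` only and an operator
depending on `y` only. -/
def HasSepRank (r : ℕ) (T : X → Y → Matrix (α × β) (α × β) ℂ) : Prop :=
  ∃ (A : Fin r → X → Matrix α α ℂ) (B : Fin r → Y → Matrix β β ℂ),
    ∀ x y, T x y = ∑ i, A i x ⊗ₖ B i y

theorem HasSepRank.of_fintype {ι : Type} [Fintype ι] {r : ℕ} (hr : Fintype.card ι = r)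
    {T : X → Y → Matrix (α × β) (α × β) ℂ} (A : ι → X → Matrix α α ℂ) (B : ι → Y → Matrix β β ℂ)
    (h : ∀ x y, T x y = ∑ i, A i x ⊗ₖ B i y) : HasSepRank r T := by
  subst hr
  let e := Fintype.equivFin ι
  refine ⟨fun i => A (e.symm i), fun i => B (e.symm i), fun x y => ?_⟩
  rw [h]
  exact Fintype.sum_equiv e _ _ fun i => by simp

theorem HasSepRank.product (A : X → Matrix α α ℂ) (B : Y → Matrix β β ℂ) :
    HasSepRank 1 fun x y => A x ⊗ₖ B y :=
  ⟨fun _ => A, fun _ => B, fun x y => by simp⟩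

theorem HasSepRank.comp {r : ℕ} {T : X → Y → Matrix (α × β) (α × β) ℂ} (hT : HasSepRank r T)
    (f : X' → X) (g : Y' → Y) : HasSepRank r fun x y => T (f x) (g y) := by
  obtain ⟨A, B, h⟩ := hT
  exact ⟨fun i x => A i (f x), fun i y => B i (g y), fun x y => h _ _⟩

theorem HasSepRank.sum_bool {r : ℕ} {T : Bool → X → Y → Matrix (α × β) (α × β) ℂ}
    (hT : ∀ m, HasSepRank r (T m)) : HasSepRank (2 * r) fun x y => ∑ m, T m x y := by
  choose A B h using hT
  refine HasSepRank.of_fintype (ι := Bool × Fin r) (by simp) (fun i => A i.1 i.2)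
    (fun i => B i.1 i.2) fun x y => ?_
  simp only [h, Fintype.sum_prod_type]

variable [Fintype α] [Fintype β]

theorem HasSepRank.conj {r : ℕ} {T : X → Y → Matrix (α × β) (α × β) ℂ} (hT : HasSepRank r T)
    (C : X → Matrix α α ℂ) (D : Y → Matrix β β ℂ) :
    HasSepRank r fun x y => (C x ⊗ₖ D y)ᴴ * T x y * (C x ⊗ₖ D y) := by
  obtain ⟨A, B, h⟩ := hT
  refine ⟨fun i x => (C x)ᴴ * A i x * C x, fun i y => (D y)ᴴ * B i y * D y, fun x y => ?_⟩
  simp only [h, Finset.mul_sum, Finset.sum_mul, Matrix.conjTranspose_kronecker,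
    Matrix.mul_kronecker_mul]

theorem HasSepRank.mul {r s : ℕ} {T : X → Y → Matrix (α × β) (α × β) ℂ}
    {S : X' → Y' → Matrix (α × β) (α × β) ℂ} (hT : HasSepRank r T) (hS : HasSepRank s S) :
    HasSepRank (r * s) fun (x : X × X') (y : Y × Y') => T x.1 y.1 * S x.2 y.2 := by
  obtain ⟨A, B, h⟩ := hT
  obtain ⟨C, D, h'⟩ := hS
  refine HasSepRank.of_fintype (ι := Fin r × Fin s) (by simp) (fun i x => A i.1 x.1 * C i.2 x.2)
    (fun i y => B i.1 y.1 * D i.2 y.2) fun x y => ?_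
  simp only [h, h', Fintype.sum_prod_type, Finset.sum_mul_sum, Matrix.mul_kronecker_mul]

/-- Matrix elements of a family of separable rank `r` form a matrix of rank `O(r)`. -/
theorem HasSepRank.rank_le [Fintype X] [Fintype Y] {r : ℕ}
    {T : X → Y → Matrix (α × β) (α × β) ℂ} (hT : HasSepRank r T) (φ ψ : α × β → ℂ) :
    (Matrix.of fun x y => φ ⬝ᵥ T x y *ᵥ ψ).rank ≤ r * Fintype.card (α × β) ^ 2 := by
  classical
  obtain ⟨A, B, h⟩ := hT
  -- Each entry is a sum over `i` and over the row and column labels of `T x y` of an `x`-factor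
  -- times a `y`-factor, so the inner index set gives the bound. The squared dimension is harmless:
  -- it does not grow under amplification.
  let L : Matrix X (Fin r × ((α × β) × (α × β))) ℂ :=
    Matrix.of fun x j => φ j.2.1 * A j.1 x j.2.1.1 j.2.2.1
  let R : Matrix (Fin r × ((α × β) × (α × β))) Y ℂ :=
    Matrix.of fun j y => B j.1 y j.2.1.2 j.2.2.2 * ψ j.2.2
  have key : (Matrix.of fun x y => φ ⬝ᵥ T x y *ᵥ ψ) = L * R := by
    ext x y
    have hF : ∀ F : Fin r × ((α × β) × (α × β)) → ℂ,
        ∑ j, F j = ∑ p, ∑ q, ∑ i, F (i, (p, q)) := by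
      intro F
      rw [Fintype.sum_prod_type_right, Fintype.sum_prod_type]
    simp only [Matrix.mul_apply, hF, Matrix.of_apply, h, dotProduct, Matrix.mulVec, L, R,
      Matrix.sum_apply, Matrix.kroneckerMap_apply, Finset.mul_sum, Finset.sum_mul]
    exact Finset.sum_congr rfl fun p _ => Finset.sum_congr rfl fun q _ =>
      Finset.sum_congr rfl fun i _ => by ring
  rw [key]
  calc (L * R).rank ≤ L.rank := Matrix.rank_mul_le_left L R
    _ ≤ Fintype.card (Fin r × ((α × β) × (α × β))) := Matrix.rank_le_card_width L
    _ = r * Fintype.card (α × β) ^ 2 := by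
      rw [Fintype.card_prod, Fintype.card_prod, Fintype.card_fin, sq]

/-- If `ψ` is an eigenvector of every `T x y`, then the matrix of the eigenvalues, when it is
invertible, has size at most the separable rank of `T`. -/
theorem HasSepRank.card_le_of_eigenvector [DecidableEq α] [DecidableEq β]
    [Fintype X] [DecidableEq X] {r : ℕ}
    {T : X → X → Matrix (α × β) (α × β) ℂ} (hT : HasSepRank r T) {ψ : α × β → ℂ}
    (hψ : star ψ ⬝ᵥ ψ = 1) (M N : Matrix X X ℂ) (hM : ∀ x y, T x y *ᵥ ψ = M x y • ψ)
    (hMN : M * N = 1) : Fintype.card X ≤ r := by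
  -- Amplification on a single copy of `ψ`: the operators act one after another on the same space,
  -- so the eigenvalues and the separable ranks multiply while the dimension stays fixed.
  have power : ∀ m : ℕ, ∃ S : (Fin m → X) → (Fin m → X) → Matrix (α × β) (α × β) ℂ,
      HasSepRank (r ^ m) S ∧ ∀ x y, S x y *ᵥ ψ = (∏ i, M (x i) (y i)) • ψ := by
    intro m
    induction m with
    | zero =>
      refine ⟨fun _ _ => 1, ?_, fun x y => by simp⟩
      have := HasSepRank.product (X := Fin 0 → X) (Y := Fin 0 → X) (fun _ => (1 : Matrix α α ℂ))
        (fun _ => (1 : Matrix β β ℂ))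
      simpa using this
    | succ m ih =>
      obtain ⟨S, hS, hSψ⟩ := ih
      refine ⟨fun x y => S (Fin.tail x) (Fin.tail y) * T (x 0) (y 0), ?_, fun x y => ?_⟩
      · exact (hS.mul hT).comp (fun x : Fin (m + 1) → X => (Fin.tail x, x 0))
          (fun y : Fin (m + 1) → X => (Fin.tail y, y 0))
      · rw [← Matrix.mulVec_mulVec, hM, Matrix.mulVec_smul, hSψ, smul_smul, Fin.prod_univ_succ]
        rfl
  have bound : ∀ m : ℕ, Fintype.card X ^ m ≤ r ^ m * Fintype.card (α × β) ^ 2 := by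
    intro m
    obtain ⟨S, hS, hSψ⟩ := power m
    have h1 := hS.rank_le (star ψ) ψ
    -- The expectations form the `m`-th Kronecker power of `M`; the Kronecker power of `N` inverts
    -- it, so its rank is full.
    have h2 : (Matrix.of fun (x y : Fin m → X) => star ψ ⬝ᵥ S x y *ᵥ ψ) *
        (Matrix.of fun (x y : Fin m → X) => ∏ i, N (x i) (y i)) = 1 := by
      ext x y
      simp only [Matrix.mul_apply, Matrix.of_apply, hSψ, dotProduct_smul, hψ, smul_eq_mul, mul_one,
        ← Finset.prod_mul_distrib]
      have := Finset.prod_univ_sum (fun _ : Fin m => (Finset.univ : Finset X))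
        (fun i z => M (x i) z * N z (y i))
      rw [Fintype.piFinset_univ] at this
      rw [← this]
      simp only [← Matrix.mul_apply, hMN, Matrix.one_apply, funext_iff]
      rw [Finset.prod_ite_zero]
      simp
    have h3 := Matrix.rank_of_isUnit _ (IsUnit.of_mul_eq_one _ h2)
    rw [h3] at h1
    simpa using h1
  by_contra! hlt
  rcases Nat.eq_zero_or_pos r with rfl | hr
  · have := bound 1
    simp at this
    omega
  have hq : (1 : ℝ) < Fintype.card X / r := by
    rw [one_lt_div (by exact_mod_cast hr)]
    exact_mod_cast hlt
  -- If `|X| > r`, the powers of `|X| / r` eventually exceed the fixed constant.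
  obtain ⟨m, hm⟩ := pow_unbounded_of_one_lt ((Fintype.card (α × β) : ℝ) ^ 2) hq
  have hb : (Fintype.card X : ℝ) ^ m ≤ r ^ m * Fintype.card (α × β) ^ 2 := by
    exact_mod_cast bound m
  rw [div_pow, lt_div_iff₀ (by positivity)] at hm
  linarith

end SepRank

/-! ### Protocols as measurements -/

section Measurement

open scoped ComplexOrder

variable {X Y : Type} {a b : ℕ}

theorem QState.normSq_eq_dotProduct (ψ : QState a b) : (ψ.normSq : ℂ) = star ψ ⬝ᵥ ψ := by
  simp only [QState.normSq, dotProduct, Pi.star_apply, RCLike.star_def, RCLike.conj_mul]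
  push_cast
  rfl

/-- The outcome probabilities `prob` are those of a two-outcome measurement on the starting state
whose operators have separable rank `r`. -/
def IsSepMeasurement (r : ℕ) (prob : X → Y → Bool → QState a b → ℝ) : Prop :=
  ∃ T : Bool → X → Y → Matrix (Bits a × Bits b) (Bits a × Bits b) ℂ,
    (∀ c x y, (T c x y).PosSemidef) ∧ (∀ x y, ∑ c, T c x y = 1) ∧
    (∀ c x y ψ, (prob x y c ψ : ℂ) = star ψ ⬝ᵥ T c x y *ᵥ ψ) ∧ ∀ c, HasSepRank r (T c)

theorem dotProduct_conj_mulVec {m n : Type} [Fintype m] [Fintype n] (S : Matrix m n ℂ)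
    (T : Matrix m m ℂ) (ψ : n → ℂ) :
    star (S *ᵥ ψ) ⬝ᵥ T *ᵥ (S *ᵥ ψ) = star ψ ⬝ᵥ (Sᴴ * T * S) *ᵥ ψ := by
  rw [Matrix.star_mulVec, ← Matrix.dotProduct_mulVec, Matrix.mulVec_mulVec, Matrix.mulVec_mulVec,
    Matrix.mul_assoc]

/-- The bit `g` depends on the qubits of one party only. -/
def IsLocal (g : Bits a → Bits b → Bool) : Prop :=
  (∃ g' : Bits a → Bool, g = fun p _ => g' p) ∨ ∃ g' : Bits b → Bool, g = fun _ q => g' q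

/-- A local measurement of a bit. -/
theorem IsSepMeasurement.project_product (g : Bits a → Bits b → Bool)
    (hg : IsLocal g) :
    IsSepMeasurement (X := X) (Y := Y) 1
      fun _ _ c ψ => (QState.project (a := a) (b := b) (fun p => g p.1 p.2) c ψ).normSq := by
  refine ⟨fun c _ _ => Matrix.diagonal fun p => if g p.1 p.2 = c then 1 else 0, fun c x y => ?_,
    fun x y => ?_, fun c x y ψ => ?_, fun c => ?_⟩
  · refine Matrix.PosSemidef.diagonal fun p => ?_
    dsimp only [Pi.zero_apply]
    split_ifs <;> simp
  · rw [Fintype.sum_bool, Matrix.diagonal_add, ← Matrix.diagonal_one]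
    congr 1
    funext p
    cases g p.1 p.2 <;> simp
  · rw [QState.normSq_eq_dotProduct]
    simp only [dotProduct, Matrix.mulVec_diagonal, QState.project, Pi.star_apply]
    refine Finset.sum_congr rfl fun p _ => ?_
    split_ifs <;> simp
  · rcases hg with ⟨g', rfl⟩ | ⟨g', rfl⟩
    · convert HasSepRank.product (X := X) (Y := Y)
        (fun _ => Matrix.diagonal fun p => if g' p = c then (1 : ℂ) else 0)
        (fun _ => (1 : Matrix (Bits b) (Bits b) ℂ)) using 3
      rw [← Matrix.diagonal_one, Matrix.diagonal_kronecker_diagonal]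
      simp
    · convert HasSepRank.product (X := X) (Y := Y) (fun _ => (1 : Matrix (Bits a) (Bits a) ℂ))
        (fun _ => Matrix.diagonal fun p => if g' p = c then (1 : ℂ) else 0) using 3
      rw [← Matrix.diagonal_one, Matrix.diagonal_kronecker_diagonal]
      simp

/-- Measuring after local unitaries. -/
theorem IsSepMeasurement.conj {r : ℕ} {prob : X → Y → Bool → QState a b → ℝ}
    (h : IsSepMeasurement r prob) (C : X → Gate a) (D : Y → Gate b) :
    IsSepMeasurement r fun x y c ψ => prob x y c
      (((C x : Matrix (Bits a) (Bits a) ℂ) ⊗ₖ (D y : Matrix (Bits b) (Bits b) ℂ)) *ᵥ ψ) := by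
  obtain ⟨T, hpos, hsum, hprob, hrank⟩ := h
  refine ⟨fun c x y => ((C x : Matrix (Bits a) (Bits a) ℂ) ⊗ₖ (D y : Matrix (Bits b) (Bits b) ℂ))ᴴ
    * T c x y * ((C x : Matrix (Bits a) (Bits a) ℂ) ⊗ₖ (D y : Matrix (Bits b) (Bits b) ℂ)),
    fun c x y => (hpos c x y).conjTranspose_mul_mul_same _, fun x y => ?_, fun c x y ψ => ?_,
    fun c => (hrank c).conj _ _⟩
  · rw [← Finset.sum_mul, ← Finset.mul_sum, hsum, Matrix.mul_one, Matrix.conjTranspose_kronecker,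
      ← Matrix.mul_kronecker_mul]
    have h1 := Matrix.mem_unitaryGroup_iff'.1 (C x).2
    have h2 := Matrix.mem_unitaryGroup_iff'.1 (D y).2
    rw [Matrix.star_eq_conjTranspose] at h1 h2
    rw [h1, h2, Matrix.one_kronecker_one]
  · rw [hprob, dotProduct_conj_mulVec]

/-- Handing over one qubit, as a relabelling of the computational basis. -/
def handOver (a b : ℕ) : Bits (a + 1) × Bits b ≃ Bits a × Bits (b + 1) where
  toFun p := (Fin.tail p.1, Fin.cons (p.1 0) p.2)
  invFun p := (Fin.cons (p.2 0) p.1, Fin.tail p.2)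
  left_inv p := by simp
  right_inv p := by simp

theorem dotProduct_submatrix_mulVec {m n : Type} [Fintype m] [Fintype n] (e : m ≃ n)
    (T : Matrix n n ℂ) (ψ : m → ℂ) :
    star ψ ⬝ᵥ T.submatrix e e *ᵥ ψ = star (ψ ∘ e.symm) ⬝ᵥ T *ᵥ (ψ ∘ e.symm) := by
  rw [Matrix.submatrix_mulVec_equiv]
  exact Fintype.sum_equiv e _ _ fun i => by simp

theorem IsSepMeasurement.reindex {r s a' b' : ℕ} {prob : X → Y → Bool → QState a b → ℝ}
    (h : IsSepMeasurement r prob) (e : Bits a' × Bits b' ≃ Bits a × Bits b)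
    (he : ∀ T : X → Y → Matrix (Bits a × Bits b) (Bits a × Bits b) ℂ, HasSepRank r T →
      HasSepRank s fun x y => (T x y).submatrix e e) :
    IsSepMeasurement s fun x y c (ψ : QState a' b') => prob x y c (ψ ∘ e.symm) := by
  obtain ⟨T, hpos, hsum, hprob, hrank⟩ := h
  refine ⟨fun c x y => (T c x y).submatrix e e, fun c x y => (hpos c x y).submatrix _,
    fun x y => ?_, fun c x y ψ => ?_, fun c => he _ (hrank c)⟩
  · have := congrArg (fun M => Matrix.submatrix M e e) (hsum x y)
    simpa [Fintype.sum_bool, Matrix.submatrix_add] using this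
  · rw [hprob, dotProduct_submatrix_mulVec]

/-- The operator `|s⟩⟨t| ⊗ A` on the first and the other qubits. -/
def consOp (s t : Bool) (A : Matrix (Bits a) (Bits a) ℂ) : Matrix (Bits (a + 1)) (Bits (a + 1)) ℂ :=
  Matrix.of fun p q => if p 0 = s ∧ q 0 = t then A (Fin.tail p) (Fin.tail q) else 0

/-- The block `⟨s|B|t⟩` with respect to the first qubit. -/
def consBlock (s t : Bool) (B : Matrix (Bits (b + 1)) (Bits (b + 1)) ℂ) :
    Matrix (Bits b) (Bits b) ℂ :=
  Matrix.of fun p q => B (Fin.cons s p) (Fin.cons t q)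

theorem sum_bool_ite_and (u v : Bool) (f : Bool → Bool → ℂ) :
    ∑ s, ∑ t, (if u = s ∧ v = t then f s t else 0) = f u v := by
  cases u <;> cases v <;> simp

/-- Write each `B` on Bob's side as a sum over `s, t` of `|s⟩⟨t|` tensor a block. Before the
hand-over the matrix unit belongs to Alice's factor and the block to Bob's: four terms for one. -/
theorem HasSepRank.submatrix_handOver {r : ℕ}
    {T : X → Y → Matrix (Bits a × Bits (b + 1)) (Bits a × Bits (b + 1)) ℂ} (hT : HasSepRank r T) :
    HasSepRank (4 * r) fun x y => (T x y).submatrix (handOver a b) (handOver a b) := by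
  obtain ⟨A, B, h⟩ := hT
  refine HasSepRank.of_fintype (ι := Fin r × Bool × Bool) (by simp; ring)
    (fun i x => consOp i.2.1 i.2.2 (A i.1 x)) (fun i y => consBlock i.2.1 i.2.2 (B i.1 y))
    fun x y => ?_
  ext p q
  simp only [h, Matrix.submatrix_apply, Matrix.sum_apply, Matrix.kroneckerMap_apply, handOver,
    Equiv.coe_fn_mk, Fintype.sum_prod_type, consOp, consBlock, Matrix.of_apply, ite_mul, zero_mul]
  refine Finset.sum_congr rfl fun i _ => ?_
  rw [sum_bool_ite_and (p.1 0) (q.1 0) fun s t => A i x (Fin.tail p.1) (Fin.tail q.1) *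
    B i y (Fin.cons s p.2) (Fin.cons t q.2)]

theorem HasSepRank.submatrix_handOver_symm {r : ℕ}
    {T : X → Y → Matrix (Bits (a + 1) × Bits b) (Bits (a + 1) × Bits b) ℂ} (hT : HasSepRank r T) :
    HasSepRank (4 * r) fun x y => (T x y).submatrix (handOver a b).symm (handOver a b).symm := by
  obtain ⟨A, B, h⟩ := hT
  refine HasSepRank.of_fintype (ι := Fin r × Bool × Bool) (by simp; ring)
    (fun i x => consBlock i.2.1 i.2.2 (A i.1 x)) (fun i y => consOp i.2.1 i.2.2 (B i.1 y))
    fun x y => ?_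
  ext p q
  simp only [h, Matrix.submatrix_apply, Matrix.sum_apply, Matrix.kroneckerMap_apply, handOver,
    Equiv.coe_fn_symm_mk, Fintype.sum_prod_type, consOp, consBlock, Matrix.of_apply, mul_ite,
    mul_zero]
  refine Finset.sum_congr rfl fun i _ => ?_
  rw [sum_bool_ite_and (p.2 0) (q.2 0) fun s t => A i x (Fin.cons s p.1) (Fin.cons t q.1) *
    B i y (Fin.tail p.2) (Fin.tail q.2)]

/-- Induction from the final measurement backwards. The bit read off must be local, so that its
projectors are single product terms. -/
theorem QubitProtocol.isSepMeasurement {a b : ℕ} (P : QubitProtocol X Y a b)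
    (g : Bits a → Bits b → Bool) (hg : IsLocal g) :
    IsSepMeasurement (4 ^ P.cost) fun x y c ψ => P.outProb x y c (fun p => g p.1 p.2) ψ := by
  induction P with
  | done => exact IsSepMeasurement.project_product g hg
  | alice U next ih =>
    have h := ((ih (fun _ q => q 0) (Or.inr ⟨_, rfl⟩)).reindex (handOver _ _)
      fun T hT => hT.submatrix_handOver).conj U fun _ => 1
    rw [QubitProtocol.cost, pow_succ']
    exact h
  | bob V next ih =>
    have h := ((ih (fun p _ => p 0) (Or.inl ⟨_, rfl⟩)).reindex (handOver _ _).symm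
      fun T hT => hT.submatrix_handOver_symm).conj (fun _ => 1) V
    rw [QubitProtocol.cost, pow_succ']
    exact h

/-- Measuring a bit locally after local unitaries, and continuing depending on the outcome. -/
theorem IsSepMeasurement.branch {r : ℕ} {prob : Bool → X → Y → Bool → QState a b → ℝ}
    (h : ∀ m, IsSepMeasurement r (prob m)) (C : X → Gate a) (D : Y → Gate b)
    (g : Bits a → Bits b → Bool) (hg : IsLocal g) :
    IsSepMeasurement (2 * r) fun x y c ψ => ∑ m, prob m x y c (QState.project (fun p => g p.1 p.2) m
      (((C x : Matrix (Bits a) (Bits a) ℂ) ⊗ₖ (D y : Matrix (Bits b) (Bits b) ℂ)) *ᵥ ψ)) := by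
  refine IsSepMeasurement.conj (prob := fun x y c ψ =>
    ∑ m, prob m x y c (QState.project (fun p => g p.1 p.2) m ψ)) ?_ C D
  choose T hpos hsum hprob hrank using h
  let E : Bool → Matrix (Bits a × Bits b) (Bits a × Bits b) ℂ := fun m =>
    Matrix.diagonal fun p => if g p.1 p.2 = m then 1 else 0
  have hE : ∀ m (ψ : QState a b), QState.project (fun p => g p.1 p.2) m ψ = E m *ᵥ ψ := by
    intro m ψ
    funext p
    simp [E, Matrix.mulVec_diagonal, QState.project]
  have hsep : ∀ m, ∃ (A : Matrix (Bits a) (Bits a) ℂ) (B : Matrix (Bits b) (Bits b) ℂ),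
      E m = A ⊗ₖ B := by
    intro m
    rcases hg with ⟨g', rfl⟩ | ⟨g', rfl⟩
    · refine ⟨Matrix.diagonal fun p => if g' p = m then (1 : ℂ) else 0, 1, ?_⟩
      rw [← Matrix.diagonal_one, Matrix.diagonal_kronecker_diagonal]
      simp [E]
    · refine ⟨1, Matrix.diagonal fun p => if g' p = m then (1 : ℂ) else 0, ?_⟩
      rw [← Matrix.diagonal_one, Matrix.diagonal_kronecker_diagonal]
      simp [E]
  choose A B hAB using hsep
  refine ⟨fun c x y => ∑ m, (E m)ᴴ * T m c x y * E m, fun c x y =>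
    Matrix.posSemidef_sum _ fun m _ => (hpos m c x y).conjTranspose_mul_mul_same _,
    fun x y => ?_, fun c x y ψ => ?_, fun c => ?_⟩
  · rw [Finset.sum_comm]
    simp only [← Finset.sum_mul, ← Finset.mul_sum, hsum, Matrix.mul_one]
    rw [Fintype.sum_bool]
    simp only [E, Matrix.diagonal_conjTranspose, Matrix.diagonal_mul_diagonal, Matrix.diagonal_add]
    rw [← Matrix.diagonal_one]
    congr 1
    funext p
    cases h : g p.1 p.2 <;> simp [h]
  · push_cast
    rw [Matrix.sum_mulVec, dotProduct_sum]
    exact Finset.sum_congr rfl fun m _ => by rw [hprob, hE, dotProduct_conj_mulVec]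
  · refine HasSepRank.sum_bool fun m => ?_
    rw [hAB m]
    exact (hrank m c).conj (fun _ => A m) fun _ => B m

theorem BitProtocol.isSepMeasurement {s : List Party} (P : BitProtocol X Y a b s) (chan : Bool) :
    IsSepMeasurement (2 ^ s.length) fun x y c ψ => P.outProb x y c chan ψ := by
  induction P generalizing chan with
  | done =>
    -- Once everything is sent, the output is a known constant, which is trivially a local bit.
    convert IsSepMeasurement.project_product (X := X) (Y := Y) (a := a) (b := b)
      (fun _ _ => chan) (Or.inl ⟨_, rfl⟩) using 1
    · rfl
    funext x y c ψ
    by_cases h : chan = c <;> simp [BitProtocol.outProb, QState.project, h, QState.normSq]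
  | alice i U next ih =>
    rw [List.length_cons, pow_succ']
    exact IsSepMeasurement.branch (fun m => ih m m) U (fun _ => 1) (fun p _ => p i)
      (Or.inl ⟨_, rfl⟩)
  | bob j V next ih =>
    rw [List.length_cons, pow_succ']
    exact IsSepMeasurement.branch (fun m => ih m m) (fun _ => 1) V (fun _ q => q j)
      (Or.inr ⟨_, rfl⟩)

/-- An exact measurement acts on its starting state as multiplication by the function computed. -/
theorem IsSepMeasurement.card_le {X : Type} [Fintype X] [DecidableEq X] {r : ℕ}
    {prob : X → X → Bool → QState a b → ℝ} (h : IsSepMeasurement r prob) {f : X → X → Bool}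
    {ψ : QState a b} (hψ : ψ.normSq = 1) (hf : ∀ x y, prob x y (f x y) ψ = 1) (c : Bool)
    (N : Matrix X X ℂ) (hN : (Matrix.of fun x y => if f x y = c then 1 else 0) * N = 1) :
    Fintype.card X ≤ r := by
  obtain ⟨T, hpos, hsum, hprob, hrank⟩ := h
  have hψ' : star ψ ⬝ᵥ ψ = 1 := by rw [← QState.normSq_eq_dotProduct, hψ, Complex.ofReal_one]
  have hsum' : ∀ x y c, T c x y + T (!c) x y = 1 := by
    intro x y c
    rw [← hsum x y, Fintype.sum_bool]
    cases c
    · exact add_comm _ _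
    · rfl
  -- The wrong outcome has expectation `1 - 1 = 0`, and a positive semidefinite operator with zero
  -- expectation annihilates the vector.
  have hnot : ∀ x y, T (!(f x y)) x y *ᵥ ψ = 0 := by
    intro x y
    rw [← (hpos _ x y).dotProduct_mulVec_zero_iff, eq_sub_of_add_eq' (hsum' x y (f x y)),
      Matrix.sub_mulVec, dotProduct_sub, Matrix.one_mulVec, hψ', ← hprob, hf]
    simp
  have hyes : ∀ x y, T (f x y) x y *ᵥ ψ = ψ := by
    intro x y
    rw [eq_sub_of_add_eq (hsum' x y (f x y)), Matrix.sub_mulVec, hnot, Matrix.one_mulVec, sub_zero]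
  refine (hrank c).card_le_of_eigenvector hψ' _ N (fun x y => ?_) hN
  by_cases hc : f x y = c
  · subst hc
    simp [hyes]
  · have : c = !(f x y) := by revert hc; cases f x y <;> cases c <;> simp
    subst this
    simp [hnot]

end Measurement

end


noncomputable section

/-! ### The communication matrices -/

section CommMatrix

variable {n : ℕ}

theorem sum_bits_prod (g : Fin n → Bool → ℝ) : ∑ t : Bits n, ∏ i, g i (t i) = ∏ i, ∑ u, g i u := by
  rw [Finset.prod_univ_sum, Fintype.piFinset_univ]

/-- The sign `(-1) ^ |x ∧ y|`. -/
def walsh (x y : Bits n) : ℝ := ∏ i, if x i && y i then -1 else 1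

theorem walsh_mul_self (x y : Bits n) : walsh x y * walsh x y = 1 := by
  rw [walsh, ← Finset.prod_mul_distrib]
  exact Finset.prod_eq_one fun i _ => by split_ifs <;> norm_num

theorem walsh_comm (x y : Bits n) : walsh x y = walsh y x := by
  simp only [walsh, Bool.and_comm]

theorem walsh_false_left (y : Bits n) : walsh (fun _ => false) y = 1 := by
  simp [walsh]

theorem walsh_false_right (y : Bits n) : walsh y (fun _ => false) = 1 := by
  simp [walsh]

theorem sum_walsh_mul_walsh (x y : Bits n) :
    ∑ t, walsh x t * walsh y t = if x = y then 2 ^ n else 0 := by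
  simp only [walsh, ← Finset.prod_mul_distrib]
  rw [sum_bits_prod fun i u => (if x i && u then (-1 : ℝ) else 1) * if y i && u then -1 else 1]
  have : ∀ i, ∑ u, ((if x i && u then (-1 : ℝ) else 1) * if y i && u then -1 else 1) =
      if x i = y i then 2 else 0 := by
    intro i
    cases x i <;> cases y i <;> norm_num
  simp only [this, Finset.prod_ite_zero, funext_iff, Finset.mem_univ, true_imp_iff]
  simp

theorem walsh_eq_pow (x y : Bits n) : walsh x y = (-1) ^ (x.and y).weight := by
  rw [walsh, Finset.prod_ite]
  simp [Bits.weight, Bits.and]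

/-- The `0`-`1` matrix of the positions at which `f` has the value `c`. -/
def levelMatrix {X Y : Type} (f : X → Y → Bool) (c : Bool) : Matrix X Y ℝ :=
  Matrix.of fun x y => if f x y = c then 1 else 0

theorem levelMatrix_EQ : levelMatrix (EQ n) true * 1 = 1 := by
  rw [mul_one]
  ext x y
  simp [levelMatrix, EQ, Matrix.one_apply]

theorem exists_levelMatrix_DISJ_mul_eq_one :
    ∃ N : Matrix (Bits n) (Bits n) ℝ, levelMatrix (DISJ n) true * N = 1 := by
  -- The matrix of DISJ is the Kronecker power of `[[1, 1], [1, 0]]`; this is the Kronecker power of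
  -- its inverse `[[0, 1], [1, -1]]`.
  refine ⟨Matrix.of fun x y => ∏ i, if x i then if y i then -1 else 1 else if y i then 1 else 0, ?_⟩
  have hM : ∀ x y, levelMatrix (DISJ n) true x y = ∏ i, if x i && y i then (0 : ℝ) else 1 := by
    intro x y
    have h1 : ∀ i, (if x i && y i then (0 : ℝ) else 1) = if ¬ (x i && y i) = true then 1 else 0 :=
      fun i => by split_ifs <;> simp_all
    simp only [h1, Finset.prod_ite_zero, Finset.prod_const_one]
    simp [levelMatrix, DISJ, Bits.weight, Bits.and, Finset.filter_eq_empty_iff]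
  ext x y
  simp only [Matrix.mul_apply, hM, Matrix.of_apply, ← Finset.prod_mul_distrib]
  rw [sum_bits_prod fun i u => (if x i && u then (0 : ℝ) else 1) *
    if u then if y i then -1 else 1 else if y i then 1 else 0]
  have : ∀ i, ∑ u, ((if x i && u then (0 : ℝ) else 1) *
      if u then if y i then -1 else 1 else if y i then 1 else 0) = if x i = y i then 1 else 0 := by
    intro i
    cases x i <;> cases y i <;> norm_num
  simp only [this, Finset.prod_ite_zero, Matrix.one_apply, funext_iff, Finset.mem_univ,
    true_imp_iff]
  simp

/-- The value `false` is essential for a uniform statement: the matrix of IP itself has a zero row.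
A protocol for IP bounds both outcomes, so the complement may be used. -/
theorem exists_levelMatrix_IP_mul_eq_one :
    ∃ N : Matrix (Bits n) (Bits n) ℝ, levelMatrix (IP n) false * N = 1 := by
  let o : Bits n := fun _ => false
  -- The matrix is `(J + H) / 2` with `J` all ones and `H` the Walsh matrix. Since `H * H = 2 ^ n`,
  -- multiplying by `2 H / 2 ^ n` gives the identity plus an all-ones column at `o`, which the
  -- correction at `(o, o)` removes.
  refine ⟨Matrix.of fun x y => 2 * walsh x y / 2 ^ n - if x = o ∧ y = o then 1 else 0, ?_⟩
  have hM : ∀ x y, levelMatrix (IP n) false x y = (walsh o y + walsh x y) / 2 := by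
    intro x y
    rw [walsh_false_left, walsh_eq_pow]
    rcases Nat.even_or_odd (x.and y).weight with h | h
    · simp [levelMatrix, IP, h, h.neg_one_pow]
    · simp [levelMatrix, IP, h, h.neg_one_pow]
  ext x y
  simp only [Matrix.mul_apply, hM, Matrix.of_apply]
  have h1 : ∀ t, (walsh o t + walsh x t) / 2 * (2 * walsh t y / 2 ^ n -
      if t = o ∧ y = o then 1 else 0) = (walsh o t * walsh y t) / 2 ^ n +
      (walsh x t * walsh y t) / 2 ^ n - if t = o then (if y = o then 1 else 0) else 0 := by
    intro t
    rw [walsh_comm t y]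
    by_cases ht : t = o
    · subst ht
      simp only [o, walsh_false_right, true_and, if_true]
      ring
    · simp only [ht, false_and, if_false]
      ring
  simp only [h1, Finset.sum_sub_distrib, Finset.sum_add_distrib, ← Finset.sum_div,
    sum_walsh_mul_walsh, Finset.sum_ite_eq', Finset.mem_univ, if_true, Matrix.one_apply, ite_div,
    zero_div, div_self (pow_ne_zero n (two_ne_zero (α := ℝ)))]
  rw [if_congr (eq_comm (a := o)) rfl rfl]
  ring

theorem rank_levelMatrix {f : Bits n → Bits n → Bool} {c : Bool} {N : Matrix (Bits n) (Bits n) ℝ}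
    (h : levelMatrix f c * N = 1) : (levelMatrix f c).rank = 2 ^ n := by
  rw [Matrix.rank_of_isUnit _ (IsUnit.of_mul_eq_one _ h)]
  simp

theorem commMatrix_complement {X Y : Type} (f : X → Y → Bool) :
    commMatrix (complement f) = levelMatrix f false := by
  ext x y
  simp [commMatrix, complement, levelMatrix]

end CommMatrix

/-! ### The lower bounds -/

section LowerBound

variable {n : ℕ}

theorem QState.initial_append (k a b : ℕ) (u v : Bits k) (s : Bits a) (t : Bits b) :
    QState.initial k a b (Fin.append u s, Fin.append v t) =
      if u = v ∧ s = (fun _ => false) ∧ t = (fun _ => false)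
      then (((Real.sqrt 2)⁻¹ : ℝ) : ℂ) ^ k else 0 := by
  simp [QState.initial, funext_iff]

theorem norm_inv_sqrt_two_pow_sq (k : ℕ) :
    ‖(((Real.sqrt 2)⁻¹ : ℝ) : ℂ) ^ k‖ ^ 2 = (2 ^ k)⁻¹ := by
  rw [norm_pow, Complex.norm_real, ← pow_mul, mul_comm, pow_mul, Real.norm_eq_abs, sq_abs, inv_pow,
    Real.sq_sqrt (by norm_num), inv_pow]

theorem QState.normSq_initial (k a b : ℕ) : (QState.initial k a b).normSq = 1 := by
  rw [QState.normSq, ← Equiv.sum_comp ((Fin.appendEquiv k a).prodCongr (Fin.appendEquiv k b))]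
  have h : ∀ p : (Bits k × Bits a) × (Bits k × Bits b),
      ‖QState.initial k a b ((Fin.appendEquiv k a).prodCongr (Fin.appendEquiv k b) p)‖ ^ 2 =
        if p.1.1 = p.2.1 ∧ p.1.2 = (fun _ => false) ∧ p.2.2 = (fun _ => false)
        then (2 ^ k)⁻¹ else 0 := by
    rintro ⟨⟨u, s⟩, ⟨v, t⟩⟩
    have := QState.initial_append k a b u v s t
    simp only [Equiv.prodCongr_apply, Prod.map, Fin.appendEquiv, Equiv.coe_fn_mk] at this ⊢
    rw [this]
    split_ifs
    · exact norm_inv_sqrt_two_pow_sq k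
    · simp
  rw [Finset.sum_congr rfl fun p _ => h p]
  simp [Fintype.sum_prod_type, ite_and]

theorem IsSepMeasurement.two_pow_le {k a b r : ℕ}
    {prob : Bits n → Bits n → Bool → QState (k + a) (k + b) → ℝ} (h : IsSepMeasurement r prob)
    {f : Bits n → Bits n → Bool} (hf : ∀ x y, prob x y (f x y) (QState.initial k a b) = 1)
    {c : Bool} {N : Matrix (Bits n) (Bits n) ℝ} (hN : levelMatrix f c * N = 1) : 2 ^ n ≤ r := by
  have := h.card_le (QState.normSq_initial k a b) hf c (N.map Complex.ofRealHom) (by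
    have h1 := congrArg (fun M => M.map Complex.ofRealHom) hN
    simp only [Matrix.map_mul] at h1
    rw [Matrix.map_one _ (map_zero _) (map_one _)] at h1
    rw [← h1]
    congr 1
    ext x y
    simp only [levelMatrix, Matrix.map_apply, Matrix.of_apply]
    split_ifs <;> simp)
  simpa using this

theorem le_cStar {f : Bits n → Bits n → Bool} {c : Bool} {N : Matrix (Bits n) (Bits n) ℝ}
    (hN : levelMatrix f c * N = 1) : (n : ℕ∞) ≤ cStar f := by
  refine le_sInf ?_
  rintro _ ⟨k, a, b, s, P, hP, rfl⟩
  have := (P.isSepMeasurement false).two_pow_le hP hN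
  exact_mod_cast (Nat.pow_le_pow_iff_right (by norm_num)).1 this

theorem le_qStar {f : Bits n → Bits n → Bool} {c : Bool} {N : Matrix (Bits n) (Bits n) ℝ}
    (hN : levelMatrix f c * N = 1) : (n : ℝ≥0∞) / 2 ≤ (qStar f : ℝ≥0∞) := by
  -- Costs are integers, so `2 ^ n ≤ 4 ^ cost` gives the rounded-up half of `n`.
  have h : (((n + 1) / 2 : ℕ) : ℕ∞) ≤ qStar f := by
    refine le_sInf ?_
    rintro _ ⟨k, a, b, P, hP, rfl⟩
    have := (P.isSepMeasurement (fun _ _ => false) (Or.inl ⟨_, rfl⟩)).two_pow_le hP hN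
    rw [show 4 = 2 ^ 2 from rfl, ← pow_mul, Nat.pow_le_pow_iff_right (by norm_num)] at this
    rw [Nat.cast_le]
    omega
  calc (n : ℝ≥0∞) / 2 ≤ (((n + 1) / 2 : ℕ) : ℝ≥0∞) := by
        rw [ENNReal.div_le_iff (by norm_num) (by norm_num)]
        have : n ≤ (n + 1) / 2 * 2 := by omega
        exact_mod_cast this
    _ = ((((n + 1) / 2 : ℕ) : ℕ∞) : ℝ≥0∞) := by simp only [ENat.toENNReal_coe]
    _ ≤ (qStar f : ℝ≥0∞) := ENat.toENNReal_le.2 h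

end LowerBound

end


noncomputable section

/-! ### The upper bounds -/

section UpperBound

variable {X Y : Type}

/-- The unitary `X^c Z^d` for bit strings `c` and `d`. -/
def pauli {n : ℕ} (c d : Bits n) : Gate n :=
  ⟨Matrix.of fun s t => if s = (fun i => xor (t i) (c i)) then (walsh d t : ℂ) else 0, by
    rw [Matrix.mem_unitaryGroup_iff']
    ext t t'
    simp only [Matrix.mul_apply, Matrix.star_apply, Matrix.of_apply, apply_ite star, star_zero,
      mul_ite, mul_zero, Finset.sum_ite_eq', Finset.mem_univ, if_true, Matrix.one_apply]
    have h : (fun i => xor (t' i) (c i)) = (fun i => xor (t i) (c i)) ↔ t = t' := by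
      simp [funext_iff, eq_comm]
    simp only [h, ite_mul, zero_mul, RCLike.star_def, Complex.conj_ofReal]
    split_ifs with ht
    · rw [ht, ← Complex.ofReal_mul, walsh_mul_self, Complex.ofReal_one]
    · rfl⟩

/-- The Pauli operators are orthogonal for the trace form, which yields the `4 ^ n` orthogonal
messages of superdense coding. -/
theorem trace_pauli {n : ℕ} (c d c' d' : Bits n) :
    Matrix.trace ((pauli c d : Matrix (Bits n) (Bits n) ℂ)ᴴ * (pauli c' d').1) =
      if c = c' ∧ d = d' then 2 ^ n else 0 := by
  have h : ∀ t : Bits n, (fun i => xor (t i) (c' i)) = (fun i => xor (t i) (c i)) ↔ c = c' := by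
    simp [funext_iff, eq_comm]
  simp only [Matrix.trace, Matrix.diag_apply, Matrix.mul_apply, Matrix.conjTranspose_apply, pauli,
    Matrix.of_apply, apply_ite star, star_zero, mul_ite, mul_zero, Finset.sum_ite_eq',
    Finset.mem_univ, if_true, h, ite_mul, zero_mul, RCLike.star_def, Complex.conj_ofReal]
  by_cases hc : c = c'
  · simp only [hc, if_true, true_and, ← Complex.ofReal_mul, ← Complex.ofReal_sum,
      sum_walsh_mul_walsh]
    split_ifs <;> simp
  · simp [hc]

theorem QState.alice_apply {a b : ℕ} (U : Gate a) (ψ : QState a b) (p : Bits a × Bits b) :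
    ψ.alice U p = ∑ u, U.1 p.1 u * ψ (u, p.2) := by
  simp [QState.alice, Matrix.mulVec, dotProduct, Fintype.sum_prod_type, Matrix.kroneckerMap_apply,
    Matrix.one_apply]

theorem QState.bob_apply {a b : ℕ} (V : Gate b) (ψ : QState a b) (p : Bits a × Bits b) :
    ψ.bob V p = ∑ v, V.1 p.2 v * ψ (p.1, v) := by
  simp [QState.bob, Matrix.mulVec, dotProduct, Fintype.sum_prod_type, Matrix.kroneckerMap_apply,
    Matrix.one_apply]

theorem QState.normSq_single {a b : ℕ} (p : Bits a × Bits b) :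
    QState.normSq (Pi.single p 1) = 1 := by
  rw [QState.normSq, Finset.sum_eq_single p] <;> simp +contextual

theorem QState.project_single {a b : ℕ} (g : Bits a × Bits b → Bool) (m : Bool)
    (p : Bits a × Bits b) :
    QState.project g m (Pi.single p 1) = if g p = m then Pi.single p 1 else 0 := by
  funext q
  by_cases h : q = p
  · subst h
    by_cases h' : g q = m <;> simp [QState.project, h']
  · by_cases h' : g p = m <;> simp [QState.project, h, h']

/-! #### Classical communication -/

theorem QState.alice_pauli_single (u v : Bits 1) (c : Bool) :
    QState.alice (pauli (fun _ => c) fun _ => false) (Pi.single (u, v) 1) =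
      Pi.single ((fun i => xor (u i) c), v) 1 := by
  funext p
  rw [QState.alice_apply, Finset.sum_eq_single u]
  · simp [pauli, Pi.single_apply, walsh_false_left, Prod.ext_iff, ← ite_and, and_comm]
  · intro w _ hw
    simp [hw]
  · simp

theorem QState.bob_pauli_single (u v : Bits 1) (c : Bool) :
    QState.bob (pauli (fun _ => c) fun _ => false) (Pi.single (u, v) 1) =
      Pi.single (u, (fun i => xor (v i) c)) 1 := by
  funext p
  rw [QState.bob_apply, Finset.sum_eq_single v]
  · simp [pauli, Pi.single_apply, walsh_false_left, Prod.ext_iff, ite_and]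
  · intro w _ hw
    simp [hw]
  · simp

theorem BitProtocol.outProb_zero {a b : ℕ} {s : List Party} (P : BitProtocol X Y a b s) (x : X)
    (y : Y) (c chan : Bool) : P.outProb x y c chan 0 = 0 := by
  have hp : ∀ (g : Bits a × Bits b → Bool) (m : Bool), QState.project g m 0 = 0 := by
    intro g m
    funext p
    simp [QState.project]
  induction P generalizing chan with
  | done => simp [BitProtocol.outProb, QState.normSq]
  | alice i U next ih => simp [BitProtocol.outProb, QState.alice, hp, ih]
  | bob j V next ih => simp [BitProtocol.outProb, QState.bob, hp, ih]

/-- No entanglement is needed. The state stays a basis vector, and Alice's single qubit is reused,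
with `cur` the bit it currently holds. -/
theorem exists_relay_protocol (m : ℕ) (β : Fin m → X → Bool) (out : (Fin m → Bool) → Y → Bool)
    (cur : Bool) :
    ∃ P : BitProtocol X Y 1 1 (List.replicate m Party.alice ++ [Party.bob]), ∀ x y chan,
      P.outProb x y (out (fun i => β i x) y) chan
        (Pi.single ((fun _ => cur), fun _ => false) 1) = 1 := by
  induction m generalizing cur with
  | zero =>
    refine ⟨.bob 0 (fun y => pauli (fun _ => out Fin.elim0 y) fun _ => false) fun _ => .done,
      fun x y chan => ?_⟩
    have h : (fun i => β i x) = Fin.elim0 := funext fun i => i.elim0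
    rw [h]
    simp only [BitProtocol.outProb, QState.bob_pauli_single, QState.project_single, Bool.false_xor]
    simp [QState.normSq_single]
  | succ m ih =>
    choose P hP using fun c => ih (fun i => β i.succ) (fun t y => out (Fin.cons c t) y) c
    -- Flipping by `xor cur (β 0 x)` turns the content `cur` into `β 0 x`; the continuation
    -- remembers the bit sent by absorbing it into `out`.
    refine ⟨.alice 0 (fun x => pauli (fun _ => xor cur (β 0 x)) fun _ => false) P,
      fun x y chan => ?_⟩
    have h : ∀ c, xor cur (xor cur c) = c := by cases cur <;> simp
    have h' : (fun i => β i x) = Fin.cons (β 0 x) fun i => β i.succ x := by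
      funext i
      cases i using Fin.cases <;> simp
    simp only [BitProtocol.outProb, QState.alice_pauli_single, QState.project_single, h]
    rw [Fintype.sum_eq_single (β 0 x)]
    · rw [if_pos rfl, h']
      exact hP _ x y _
    · intro c hc
      rw [if_neg (Ne.symm hc), BitProtocol.outProb_zero]

theorem cStar_le {n : ℕ} (f : Bits n → Bits n → Bool) : cStar f ≤ (n : ℕ∞) + 1 := by
  obtain ⟨P, hP⟩ := exists_relay_protocol n (fun i (x : Bits n) => x i) f false
  refine sInf_le ⟨0, 1, 1, _, P, fun x y => ?_, by simp⟩
  have h : QState.initial 0 1 1 = Pi.single ((fun _ => false), fun _ => false) 1 := by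
    funext p
    simp [QState.initial, Pi.single_apply, Prod.ext_iff, funext_iff]
  rw [h]
  exact hP x y false

/-! #### Superdense coding -/

/-- Orthonormal vectors can be rotated to computational basis states. -/
theorem exists_gate_mulVec_eq_single [DecidableEq X] {b : ℕ} (φ : X → Bits b → ℂ)
    (hφ : ∀ x x', star (φ x) ⬝ᵥ φ x' = if x = x' then 1 else 0) (w : X → Bits b)
    (hw : Function.Injective w) : ∃ V : Gate b, ∀ x, V.1 *ᵥ φ x = Pi.single (w x) 1 := by
  -- Labelling `φ x` by its target `w x` and extending to an orthonormal basis makes the gate the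
  -- matrix whose rows are the conjugated basis vectors. The default 0 off the range of `w` plays no
  -- role.
  let v : Bits b → EuclideanSpace ℂ (Bits b) := fun i => WithLp.toLp 2 (Function.extend w φ 0 i)
  have hv : Orthonormal ℂ ((Set.range w).domRestrict v) := by
    rw [orthonormal_iff_ite]
    rintro ⟨_, x, rfl⟩ ⟨_, x', rfl⟩
    simp only [Set.domRestrict_apply, v, hw.extend_apply, EuclideanSpace.inner_eq_star_dotProduct,
      dotProduct_comm (φ x'), hφ]
    exact if_congr (hw.eq_iff.symm.trans Subtype.mk_eq_mk.symm) rfl rfl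
  obtain ⟨B, hB⟩ := hv.exists_orthonormalBasis_extension_of_card_eq (by simp)
  have horth : ∀ i j, ∑ t, star (B i t) * B j t = if i = j then 1 else 0 := by
    intro i j
    rw [← orthonormal_iff_ite.1 B.orthonormal i j, EuclideanSpace.inner_eq_star_dotProduct,
      dotProduct_comm]
    rfl
  refine ⟨⟨Matrix.of fun i t => star (B i t), ?_⟩, fun x => ?_⟩
  · rw [Matrix.mem_unitaryGroup_iff]
    ext i j
    simpa [Matrix.mul_apply, Matrix.one_apply] using horth i j
  · funext i
    have hx : φ x = B (w x) := by
      rw [hB _ ⟨x, rfl⟩]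
      simp [v, hw.extend_apply]
    simp only [Matrix.mulVec, dotProduct, Matrix.of_apply, hx, horth, Pi.single_apply]

/-- Alice passes on all her qubits unchanged; Bob then holds orthonormal states and rotates them to
basis states whose first bit is the answer. The factor 2 in `hcard` makes room for that bit beside
an injective label of `x`, and `hb` lets Bob send even when `a = 0`. -/
theorem exists_decoding_protocol [Fintype X] [DecidableEq X] (f : X → Y → Bool) (a b : ℕ)
    (φ : X → QState a b) (hφ : ∀ x x', star (φ x) ⬝ᵥ φ x' = if x = x' then 1 else 0)
    (hb : 0 < b) (hcard : 2 * Fintype.card X ≤ 2 ^ (a + b)) :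
    ∃ P : QubitProtocol X Y a b, P.cost = a + 1 ∧
      ∀ x y chan, P.outProb x y (f x y) chan (φ x) = 1 := by
  induction a generalizing b with
  | zero =>
    obtain _ | b := b
    · exact absurd hb (lt_irrefl 0)
    obtain ⟨ι⟩ : Nonempty (X ↪ Bits b) := Function.Embedding.nonempty_of_card_le (by
      rw [zero_add, pow_succ'] at hcard
      simpa using Nat.le_of_mul_le_mul_left hcard two_pos)
    have hφ' : ∀ x x', star (fun v => φ x (default, v)) ⬝ᵥ (fun v => φ x' (default, v)) =
        if x = x' then 1 else 0 := by
      intro x x'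
      rw [← hφ]
      simp only [dotProduct, Fintype.sum_prod_type, Fintype.sum_unique, Pi.star_apply]
      refine Finset.sum_congr rfl fun v _ => ?_
      congr!
    choose V hV using fun y => exists_gate_mulVec_eq_single _ hφ'
      (fun x => (Fin.cons (f x y) (ι x) : Bits (b + 1))) fun x x' h =>
        ι.injective (Fin.cons_injective2 h).2
    refine ⟨.bob V .done, rfl, fun x y chan => ?_⟩
    have h : ((φ x).bob (V y)).toAlice = Pi.single ((fun _ => f x y), ι x) 1 := by
      funext p
      have h1 : (φ x).bob (V y) (default, Fin.cons (p.1 0) p.2) =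
          (V y).1.mulVec (fun v => φ x (default, v)) (Fin.cons (p.1 0) p.2) :=
        QState.bob_apply _ _ _
      have h2 : ((φ x).bob (V y)).toAlice p =
          (φ x).bob (V y) (default, Fin.cons (p.1 0) p.2) := by
        rw [QState.toAlice, Subsingleton.elim (Fin.tail p.1) default]
      rw [h2, h1, hV, Pi.single_apply, Pi.single_apply]
      refine if_congr ?_ rfl rfl
      rw [Fin.cons_inj, Prod.ext_iff]
      exact and_congr_left' ⟨fun h => funext fun i => by rw [Fin.fin_one_eq_zero i]; exact h,
        fun h => congrFun h 0⟩
    simp only [QubitProtocol.outProb, h, QState.project_single, if_true, QState.normSq_single]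
  | succ a ih =>
    obtain ⟨P, hcost, hP⟩ := ih (b + 1) (fun x => (φ x).toBob) (fun x x' => by
        rw [← hφ]
        exact Fintype.sum_equiv (handOver a b).symm _ _ fun p => rfl)
      (Nat.succ_pos b) (by rw [← add_assoc, add_right_comm]; exact hcard)
    refine ⟨.alice (fun _ => 1) P, by rw [QubitProtocol.cost, hcost], fun x y chan => ?_⟩
    have h : (φ x).alice 1 = φ x := by simp [QState.alice]
    rw [QubitProtocol.outProb, h]
    exact hP x y _

theorem QState.initial_zero_one (k : ℕ) (u : Bits k) (v : Bits (k + 1)) :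
    QState.initial k 0 1 (u, v) =
      if v = Fin.snoc u false then (((Real.sqrt 2)⁻¹ : ℝ) : ℂ) ^ k else 0 := by
  rw [QState.initial]
  refine if_congr ?_ rfl rfl
  simp only [funext_iff (f := v), Fin.forall_fin_succ' (P := fun i => v i = _),
    Fin.snoc_castSucc, Fin.snoc_last]
  constructor
  · rintro ⟨h, -, h'⟩
    exact ⟨fun i => (h i).symm, h' 0⟩
  · rintro ⟨h, h'⟩
    exact ⟨fun i => (h i).symm, fun i => i.elim0, fun j => by rw [Subsingleton.elim j 0]; exact h'⟩

/-- On halves of EPR pairs, inner products of states are normalized trace inner products of the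
gates. -/
theorem dotProduct_alice_initial (k : ℕ) (U V : Gate k) :
    star ((QState.initial k 0 1).alice U) ⬝ᵥ (QState.initial k 0 1).alice V =
      Matrix.trace (U.1ᴴ * V.1) / 2 ^ k := by
  have h : ∀ (W : Gate k) (u : Bits k) (v : Bits (k + 1)),
      (QState.initial k 0 1).alice W (u, v) = if v (Fin.last k) = false
        then W.1 u (Fin.init v) * (((Real.sqrt 2)⁻¹ : ℝ) : ℂ) ^ k else 0 := by
    intro W u v
    have hv : ∀ t, v = Fin.snoc t false ↔ Fin.init v = t ∧ v (Fin.last k) = false := by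
      intro t
      conv_lhs => rw [← Fin.snoc_init_self v]
      exact Fin.snoc_inj
    refine (QState.alice_apply W _ _).trans ?_
    simp only [QState.initial_zero_one, hv, mul_ite, mul_zero, ite_and, Finset.sum_ite_eq,
      Finset.mem_univ, if_true]
  have hsum : ∀ F : Bits k → Bool → ℂ,
      ∑ v : Bits (k + 1), F (Fin.init v) (v (Fin.last k)) = ∑ t, ∑ c, F t c := by
    intro F
    rw [← (Fin.snocEquiv fun _ => Bool).sum_comp, Fintype.sum_prod_type_right]
    simp [Fin.snocEquiv]
  have hc : star ((((Real.sqrt 2)⁻¹ : ℝ) : ℂ) ^ k) * (((Real.sqrt 2)⁻¹ : ℝ) : ℂ) ^ k =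
      (2 ^ k)⁻¹ := by
    rw [RCLike.star_def, Complex.conj_mul', ← Complex.ofReal_pow, norm_inv_sqrt_two_pow_sq]
    push_cast
    rfl
  rw [Matrix.trace, Finset.sum_div, dotProduct, Fintype.sum_prod_type_right]
  simp only [Pi.star_apply, h]
  rw [hsum fun t c => ∑ u, star (if c = false then U.1 u t * (((Real.sqrt 2)⁻¹ : ℝ) : ℂ) ^ k
    else 0) * if c = false then V.1 u t * (((Real.sqrt 2)⁻¹ : ℝ) : ℂ) ^ k else 0]
  refine Finset.sum_congr rfl fun t _ => ?_
  rw [Fintype.sum_bool, Matrix.diag_apply, Matrix.mul_apply, Finset.sum_div]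
  simp only [Bool.true_eq_false, if_false, mul_zero, Finset.sum_const_zero, zero_add, if_true]
  refine Finset.sum_congr rfl fun u _ => ?_
  rw [star_mul', mul_mul_mul_comm, hc, Matrix.conjTranspose_apply, div_eq_mul_inv]

/-- Alice encodes `x` as one of `4 ^ k` Pauli operators on her EPR halves. Bob's one extra zero
qubit provides the factor 2 that decoding requires. -/
theorem exists_superdense_protocol [Fintype X] [DecidableEq X] (f : X → Y → Bool) (k : ℕ)
    (hcard : Fintype.card X ≤ 2 ^ (k + k)) :
    ∃ P : QubitProtocol X Y (k + 0) (k + 1), P.cost = k + 1 ∧ P.Computes f := by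
  obtain ⟨e⟩ : Nonempty (X ↪ Bits k × Bits k) :=
    Function.Embedding.nonempty_of_card_le (by simpa [← pow_add] using hcard)
  let φ : X → QState k (k + 1) := fun x => (QState.initial k 0 1).alice (pauli (e x).1 (e x).2)
  have hφ : ∀ x x', star (φ x) ⬝ᵥ φ x' = if x = x' then 1 else 0 := by
    intro x x'
    rw [dotProduct_alice_initial, trace_pauli,
      if_congr (Prod.ext_iff.symm.trans e.injective.eq_iff) rfl rfl]
    split_ifs <;> simp
  -- The encoding gate must accompany the first transmission. For `k = 0` there is none, but then
  -- `X` has at most one element and Bob answers alone.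
  cases k with
  | zero =>
    have : Subsingleton X := Fintype.card_le_one_iff_subsingleton.1 hcard
    obtain ⟨P, hcost, hP⟩ := exists_decoding_protocol f 0 1 (fun _ => QState.initial 0 0 1)
      (fun x x' => by
        rw [if_pos (Subsingleton.elim x x')]
        have h := QState.normSq_eq_dotProduct (QState.initial 0 0 1)
        rw [QState.normSq_initial, Complex.ofReal_one] at h
        exact h.symm)
      one_pos (by simpa using hcard)
    exact ⟨P, hcost, fun x y => hP x y _⟩
  | succ k =>
    obtain ⟨P, hcost, hP⟩ := exists_decoding_protocol f k (k + 1 + 1 + 1) (fun x => (φ x).toBob)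
      (fun x x' => by
        rw [← hφ]
        exact Fintype.sum_equiv (handOver k (k + 1 + 1)).symm _ _ fun p => rfl)
      (Nat.succ_pos _) (by
        calc 2 * Fintype.card X ≤ 2 * 2 ^ (k + 1 + (k + 1)) := Nat.mul_le_mul_left 2 hcard
          _ = 2 ^ (k + (k + 1 + 1 + 1)) := by rw [← pow_succ']; congr 1; ring)
    exact ⟨.alice (fun x => pauli (e x).1 (e x).2) P, by rw [QubitProtocol.cost, hcost],
      fun x y => hP x y _⟩

theorem qStar_le {n : ℕ} (f : Bits n → Bits n → Bool) :
    qStar f ≤ (⌈(n : ℚ) / 2⌉₊ : ℕ∞) + 1 := by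
  have hn : n ≤ ⌈(n : ℚ) / 2⌉₊ + ⌈(n : ℚ) / 2⌉₊ := by
    have := Nat.le_ceil ((n : ℚ) / 2)
    have h : (n : ℚ) ≤ ⌈(n : ℚ) / 2⌉₊ + ⌈(n : ℚ) / 2⌉₊ := by linarith
    exact_mod_cast h
  obtain ⟨P, hcost, hP⟩ := exists_superdense_protocol f ⌈(n : ℚ) / 2⌉₊
    (by simpa using Nat.pow_le_pow_right (by norm_num) hn)
  exact sInf_le ⟨_, 0, 1, P, hP, by rw [hcost]; push_cast; rfl⟩

end UpperBound

end
theorem mainTheorem5 (n : ℕ) :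
    -- the ranks of the communication matrices
    ((commMatrix (EQ n)).rank = 2 ^ n ∧
      (commMatrix (DISJ n)).rank = 2 ^ n ∧
      (commMatrix (complement (IP n))).rank = 2 ^ n) ∧
    -- the lower bounds
    (((n : ℝ≥0∞) / 2 ≤ (qStar (EQ n) : ℝ≥0∞) ∧
        (n : ℝ≥0∞) / 2 ≤ (qStar (DISJ n) : ℝ≥0∞) ∧
        (n : ℝ≥0∞) / 2 ≤ (qStar (IP n) : ℝ≥0∞)) ∧
      ((n : ℕ∞) ≤ cStar (EQ n) ∧ (n : ℕ∞) ≤ cStar (DISJ n) ∧ (n : ℕ∞) ≤ cStar (IP n))) ∧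
    -- tightness up to one (qu)bit
    ((qStar (EQ n) ≤ (⌈(n : ℚ) / 2⌉₊ : ℕ∞) + 1 ∧
        qStar (DISJ n) ≤ (⌈(n : ℚ) / 2⌉₊ : ℕ∞) + 1 ∧
        qStar (IP n) ≤ (⌈(n : ℚ) / 2⌉₊ : ℕ∞) + 1) ∧
      (cStar (EQ n) ≤ (n : ℕ∞) + 1 ∧
        cStar (DISJ n) ≤ (n : ℕ∞) + 1 ∧
        cStar (IP n) ≤ (n : ℕ∞) + 1)) := by
  obtain ⟨N, hN⟩ := exists_levelMatrix_DISJ_mul_eq_one (n := n)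
  obtain ⟨N', hN'⟩ := exists_levelMatrix_IP_mul_eq_one (n := n)
  refine ⟨⟨rank_levelMatrix levelMatrix_EQ, rank_levelMatrix hN, ?_⟩,
    ⟨⟨le_qStar levelMatrix_EQ, le_qStar hN, le_qStar hN'⟩,
      le_cStar levelMatrix_EQ, le_cStar hN, le_cStar hN'⟩,
    ⟨qStar_le _, qStar_le _, qStar_le _⟩, cStar_le _, cStar_le _, cStar_le _⟩
  rw [commMatrix_complement]
  exact rank_levelMatrix hN'
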